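/- Fix an integer $K\ge 1$ and integers $r_1,\dots,r_K$. For $T,p_1,\dots,p_K\in\mathbb N$ put $p=p_1\cdots p_K$, $p_{-k}=p/p_k$ and $$L^*=\min\{p,\;p_{-1}^2,\dots,p_{-K}^2,\;Tp_{-1},\dots,Tp_{-K}\}.$$ For $\mathcal F\in\mathbb R^{r_1\times\cdots\times r_K}$ and $\mathbf A_k\in\mathbb R^{p_k\times r_k}$, $\mathcal F\times_{k=1}^K\mathbf A_k$ is the $p_1\times\cdots\times p_K$ tensor with entries $\sum_{j_1,\dots,j_K}\mathcal F_{j_1\dots j_K}\prod_k(\mathbf A_k)_{i_kj_k}$; $\mathrm{mat}_k$ is the mode-$k$ unfolding. Let $\mathcal A_k\subset\mathbb R^{r_k}$ $(1\le k\le K)$ be closed and let $\mathscr F\subset\mathbb R^{r_1\times\cdots\times r_K}$ be closed and bounded; these sets do not depend on $T,p_1,\dots,p_K$. The parameter space $\Theta$ is the set of all $\theta=(\mathbf A_1,\dots,\mathbf A_K,\mathcal F_1,\dots,\mathcal F_T)$ such that the rows of $\mathbf A_k\in\mathbb R^{p_k\times r_k}$ lie in $\mathcal A_k$, $p_k^{-1}\mathbf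 A_k^\top\mathbf A_k=\mathbf I_{r_k}$, $\mathcal F_t\in\mathscr F$, and, for every $k$, $T^{-1}\sum_{t}\mathrm{mat}_k(\mathcal F_t)\mathrm{mat}_k(\mathcal F_t)^\top$ is a positive diagonal matrix with non-increasing diagonal elements. One observes $\mathcal X_t=\mathcal S_{0t}+\mathcal E_t$, $1\le t\le T$, with $\mathcal S_{0t}=\mathcal F_{0t}\times_{k=1}^K\mathbf A_{0k}$. As $T,p_1,\dots,p_K\to\infty$ jointly (the true parameters and the noise may form an array indexed by the dimensions), assume: 1. $\theta_0=(\mathbf A_{01},\dots,\mathbf A_{0K},\mathcal F_{01},\dots,\mathcal F_{0T})\in\Theta$ is nonrandom; $\|\mathbf A_{0k}\|_F=c_kp_k^{1/2}$ for constants $c_k>0$; and $T^{-1}\sum_t\mathrm{mat}_k(\mathcal F_{0t})\mathrm{mat}_k(\mathcal F_{0t})^\top\to\mathbf\Sigma_{0k}$, a positive definite diagonal matrix with non-increasing diagonal elements, for each $k$. 2. The entries $e_{t,i_1,\dots,i_K}$ of $\mathcal E_t$ are independent across $t$ and $i_1,\dots,i_K$. 3. $\mathbb E\,e_{t,i_1,\dots,i_K}=0$;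 there is a constant $\nu>0$ with $\mathbb E|e_{t,i_1,\dots,i_K}|^{2d}\le\frac{(2d)!}{2^dd!}\nu^{2d}$ for all $d=1,2,\dots$ and all $t,i_1,\dots,i_K$; and $\|\mathcal E_t\|_F>0$ almost surely for every $t$. Fix $\tau>0$, let $H_\tau(x)=x^2/2$ for $|x|\le\tau$ and $H_\tau(x)=\tau|x|-\tau^2/2$ for $|x|>\tau$, and let $\widehat\theta^H=(\widehat{\mathbf A}_1^H,\dots,\widehat{\mathbf A}_K^H,\widehat{\mathcal F}_1^H,\dots,\widehat{\mathcal F}_T^H)$ be, almost surely, a minimiser over $\theta\in\Theta$ of $$\frac1T\sum_{t=1}^TH_\tau\!\left(\left\|\frac{\mathcal X_t-\mathcal F_t\times_{k=1}^K\mathbf A_k}{\sqrt p}\right\|_F\right).$$ Then the common-component estimator $\widehat{\mathcal S}_t^H=\widehat{\mathcal F}_t^H\times_{k=1}^K\widehat{\mathbf A}_k^H$ satisfies $$\frac1{Tp}\sum_{t=1}^T\bigl\|\widehat{\mathcal S}_t^H-\mathcal S_{0t}\bigr\|_F^2=O_P\!\left(\frac1{L^*}\right).$$ -/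

import Mathlib

open MeasureTheory ProbabilityTheory Filter Topology

namespace TensorFactor

/-- Real tensors of size `d 0 × d 1 × ⋯ × d (K-1)`. -/
abbrev Tensor {K : ℕ} (d : Fin K → ℕ) : Type := (∀ k, Fin (d k)) → ℝ

/-- The Frobenius norm of a tensor. -/
noncomputable def Tensor.frob {K : ℕ} {d : Fin K → ℕ} (X : Tensor d) : ℝ :=
  Real.sqrt (∑ i, X i ^ 2)

/-- The Frobenius norm of a matrix. -/
noncomputable def matFrob {m n : ℕ} (A : Matrix (Fin m) (Fin n) ℝ) : ℝ :=
  Real.sqrt (∑ i, ∑ j, A i j ^ 2)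

/-- The product `F ×₁ A₁ ×₂ ⋯ ×_K A_K` of an `r₁ × ⋯ × r_K` tensor with matrices
`A_k` of size `p_k × r_k` along all of its modes:
entry `i` is `∑ j, F j * A₁ i₁ j₁ * ⋯ * A_K i_K j_K`. -/
noncomputable def tucker {K : ℕ} {p r : Fin K → ℕ} (F : Tensor r)
    (A : ∀ k, Matrix (Fin (p k)) (Fin (r k)) ℝ) : Tensor p :=
  fun i => ∑ j, F j * ∏ k, A k (i k) (j k)

/-- The mode-`k` unfolding: rows are indexed by the `k`-th index, columns by the tuple of all
other indices. -/
def unfold {K : ℕ} {d : Fin K → ℕ} (k : Fin K) (X : Tensor d) :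
    Matrix (Fin (d k)) (∀ j : {j : Fin K // j ≠ k}, Fin (d j)) ℝ :=
  fun a c => X fun j => if h : j = k then Fin.cast (congrArg d h.symm) a else c ⟨j, h⟩

/-- A value `θ = (A₁, …, A_K, F₁, …, F_T)` of the parameters. -/
structure Param {K : ℕ} (p r : Fin K → ℕ) (T : ℕ) where
  /-- the loading matrices -/
  A : ∀ k, Matrix (Fin (p k)) (Fin (r k)) ℝ
  /-- the core tensors -/
  F : Fin T → Tensor r

/-- The common component `S_t = F_t ×₁ A₁ ×₂ ⋯ ×_K A_K`. -/
noncomputable def Param.signal {K : ℕ} {p r : Fin K → ℕ} {T : ℕ} (θ : Param p r T)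
    (t : Fin T) : Tensor p :=
  tucker (θ.F t) θ.A

/-- The matrix `(1/T) ∑_t mat_k(F_t) mat_k(F_t)ᵀ`. -/
noncomputable def Param.gram {K : ℕ} {p r : Fin K → ℕ} {T : ℕ} (θ : Param p r T)
    (k : Fin K) : Matrix (Fin (r k)) (Fin (r k)) ℝ :=
  (1 / (T : ℝ)) • ∑ t, unfold k (θ.F t) * (unfold k (θ.F t)).transpose

/-- Diagonal matrices with positive, non-increasing diagonal elements. -/
def IsOrderedPosDiag {n : ℕ} (M : Matrix (Fin n) (Fin n) ℝ) : Prop :=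
  M.IsDiag ∧ (∀ a, 0 < M a a) ∧ Antitone fun a => M a a

/-- The parameter space `Θ`: the rows of `A_k` lie in `𝒜 k` and `A_kᵀ A_k / p_k = I`; the core
tensors lie in `ℱ` and their normalised mode-`k` Gram matrices are positive diagonal with
non-increasing diagonal elements. -/
def paramSpace {K : ℕ} {r : Fin K → ℕ} (𝒜 : ∀ k, Set (Fin (r k) → ℝ)) (ℱ : Set (Tensor r))
    (p : Fin K → ℕ) (T : ℕ) : Set (Param p r T) :=
  {θ | (∀ k j, θ.A k j ∈ 𝒜 k) ∧
    (∀ k, (1 / (p k : ℝ)) • ((θ.A k).transpose * θ.A k) = 1) ∧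
    (∀ t, θ.F t ∈ ℱ) ∧
    (∀ k, IsOrderedPosDiag (θ.gram k))}

/-- The Huber function with threshold `τ`. -/
noncomputable def huber (τ x : ℝ) : ℝ :=
  if |x| ≤ τ then x ^ 2 / 2 else τ * |x| - τ ^ 2 / 2

/-- The Huber loss `(1/T) ∑_t H_τ(‖X_t - F_t ×₁ A₁ ⋯ ×_K A_K‖_F / √p)`, `p = p₁ ⋯ p_K`. -/
noncomputable def huberLoss {K : ℕ} {p r : Fin K → ℕ} {T : ℕ} (τ : ℝ)
    (X : Fin T → Tensor p) (θ : Param p r T) : ℝ :=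
  (1 / (T : ℝ)) *
    ∑ t, huber τ (Tensor.frob (X t - θ.signal t) / Real.sqrt ((∏ k, p k : ℕ) : ℝ))

/-- `θ` minimises the Huber loss of the data `X` over the parameter space. -/
def IsHuberEstimate {K : ℕ} {p r : Fin K → ℕ} {T : ℕ} (𝒜 : ∀ k, Set (Fin (r k) → ℝ))
    (ℱ : Set (Tensor r)) (τ : ℝ) (X : Fin T → Tensor p) (θ : Param p r T) : Prop :=
  θ ∈ paramSpace 𝒜 ℱ p T ∧ ∀ θ' ∈ paramSpace 𝒜 ℱ p T, huberLoss τ X θ ≤ huberLoss τ X θ'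

/-- `p_{-k} = ∏_{j ≠ k} p_j`. -/
def coDim {K : ℕ} (p : Fin K → ℕ) (k : Fin K) : ℕ := ∏ j ∈ Finset.univ.erase k, p j

/-- `L* = min {p, p_{-1}², …, p_{-K}², T p_{-1}, …, T p_{-K}}`. -/
def Lstar {K : ℕ} [NeZero K] (T : ℕ) (p : Fin K → ℕ) : ℕ :=
  min (∏ k, p k)
    (min (Finset.univ.inf' Finset.univ_nonempty fun k => coDim p k ^ 2)
      (Finset.univ.inf' Finset.univ_nonempty fun k => T * coDim p k))

/-- The average squared error `(Tp)⁻¹ ∑_t ‖S_t(θ) - S_t(θ₀)‖_F²` for the common components. -/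
noncomputable def signalError {K : ℕ} {p r : Fin K → ℕ} {T : ℕ} (θ θ₀ : Param p r T) : ℝ :=
  (∑ t, Tensor.frob (θ.signal t - θ₀.signal t) ^ 2) / ((T : ℝ) * ((∏ k, p k : ℕ) : ℝ))

/-- `Y = O_P(a)` along the filter `l` (outer probability where `Y` is not measurable). -/
def IsBigOP {ι : Type*} (l : Filter ι) {Ω : ι → Type*} [∀ n, MeasurableSpace (Ω n)]
    (μ : ∀ n, Measure (Ω n)) (Y : ∀ n, Ω n → ℝ) (a : ι → ℝ) : Prop :=
  ∀ ε : ℝ, 0 < ε → ∃ C : ℝ, 0 < C ∧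
    ∀ᶠ n in l, μ n {ω | C * a n < |Y n ω|} ≤ ENNReal.ofReal ε

/-- Parameter sets and true parameters `θ₀` (nonrandom, possibly varying with the sample
dimensions): closed sets, `ℱ` bounded, `θ₀ ∈ Θ`, pervasive loadings, and convergence of the
second moments of the factors to ordered positive diagonal matrices. -/
structure ParamAssumption {ι : Type*} (l : Filter ι) {K : ℕ} {r : Fin K → ℕ}
    (𝒜 : ∀ k, Set (Fin (r k) → ℝ)) (ℱ : Set (Tensor r))
    (T : ι → ℕ) (p : ι → Fin K → ℕ) (θ₀ : ∀ n, Param (p n) r (T n)) : Prop where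
  closed_loadings : ∀ k, IsClosed (𝒜 k)
  closed_factors : IsClosed ℱ
  bounded_factors : Bornology.IsBounded ℱ
  mem : ∀ n, θ₀ n ∈ paramSpace 𝒜 ℱ (p n) (T n)
  pervasive : ∀ k, ∃ c : ℝ, 0 < c ∧ ∀ n, matFrob ((θ₀ n).A k) = c * Real.sqrt (p n k)
  gram_tendsto : ∀ k, ∃ S : Matrix (Fin (r k)) (Fin (r k)) ℝ,
    IsOrderedPosDiag S ∧ Tendsto (fun n => (θ₀ n).gram k) l (𝓝 S)

/-- The idiosyncratic components, for given sample dimensions, are independent random variables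
over `t` and over all entries. -/
structure NoiseIndep {K : ℕ} {p : Fin K → ℕ} {T : ℕ} {Ω : Type*} [MeasurableSpace Ω]
    (μ : Measure Ω) (e : Fin T → (∀ k, Fin (p k)) → Ω → ℝ) : Prop where
  measurable : ∀ t i, Measurable (e t i)
  indep : iIndepFun (fun ti : Fin T × (∀ k, Fin (p k)) => e ti.1 ti.2) μ

/-- Centred noise with the even-moment (sub-Gaussian) bound with parameter `ν`, and almost surely
nonzero noise tensors. -/
structure NoiseSubGaussian {K : ℕ} {p : Fin K → ℕ} {T : ℕ} {Ω : Type*} [MeasurableSpace Ω]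
    (μ : Measure Ω) (ν : ℝ) (e : Fin T → (∀ k, Fin (p k)) → Ω → ℝ) : Prop where
  mean_zero : ∀ t i, Integrable (e t i) μ ∧ ∫ ω, e t i ω ∂μ = 0
  moments : ∀ t i, ∀ d : ℕ, 1 ≤ d → Integrable (fun ω => |e t i ω| ^ (2 * d)) μ ∧
    ∫ ω, |e t i ω| ^ (2 * d) ∂μ
      ≤ ((2 * d).factorial : ℝ) / (2 ^ d * (d.factorial : ℝ)) * ν ^ (2 * d)
  ne_zero : ∀ t, ∀ᵐ ω ∂μ, 0 < Tensor.frob (fun i => e t i ω)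

end TensorFactor

namespace TensorFactor


/-! ### Nets of the unit ball and multilinear forms -/

/-! The Huber estimate is compared with a weighted least-squares fit. Since `z ↦ H_τ(√z)` is
concave, its tangent at the squared residual of the estimate gives weights `w_t ∈ [0, 1]`, namely
`min(1, τ / residual)`. Write `D_t` for the error of the common component and `x_t` for the noise.
Minimality then yields `∑ w_t ‖D_t‖² ≤ 2 ∑ w_t ⟨x_t, D_t⟩` (`huber_sub_huber_ge`).

The array `w_t D_t` is a sum of at most `∏ 2 r_k` rank-one arrays, so the right side is at most a
constant times `S (∑ w_t² ‖D_t‖²)^{1/2}`, where `S` bounds the noise as a multilinear form in `K +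
1` unit vectors (`abs_weighted_inner_le`). The weights depend on the data, but they are absorbed in
the time vector, over which `S` is uniform. As `w_t² ≤ w_t`, this gives `∑ w_t ‖D_t‖² = O(S²)`, and
a net argument with sub-Gaussian tails gives `S² = O_P(T + ∑ p_k)`.

To remove the weights, note that `‖D_t‖² = O(p)` always, because the factors are bounded. Hence
`w_t` is bounded below unless `‖x_t‖² > 4ν² p`, which by Chebyshev and Markov happens for only
`O_P(T / p)` times `t`, of total error `O_P(T)`. Dividing by `T p`, the error is of order `1 / p + ∑
1 / (T p_{-k})`. The entries `p_{-k}²` only make `L*` smaller. -/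

theorem exists_half_net (E : Type*) [NormedAddCommGroup E] [NormedSpace ℝ E]
    [FiniteDimensional ℝ E] :
    ∃ N : Finset E, N.card ≤ 5 ^ Module.finrank ℝ E ∧ (∀ x ∈ N, ‖x‖ ≤ 1) ∧
      ∀ x : E, ‖x‖ ≤ 1 → ∃ y ∈ N, ‖x - y‖ < 1 / 2 := by
  classical
  -- A separated subset of the ball of maximal cardinality is a net: a point it missed could be
  -- added. Doubling brings the `1/2`-separation to the unit separation in the ball of radius 2 that
  -- the packing bound expects.
  let P : Finset E → Prop := fun N =>
    (∀ x ∈ N, ‖x‖ ≤ 1) ∧ ∀ x ∈ N, ∀ y ∈ N, x ≠ y → 1 / 2 ≤ ‖x - y‖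
  have hcard : ∀ N, P N → N.card ≤ 5 ^ Module.finrank ℝ E := by
    intro N hN
    have hinj : Function.Injective fun x : E => (2 : ℝ) • x :=
      smul_right_injective E two_ne_zero
    rw [← Finset.card_image_of_injective N hinj]
    refine Besicovitch.card_le_of_separated _ ?_ ?_
    · simp only [Finset.mem_image, forall_exists_index, and_imp]
      rintro _ x hx rfl
      have := hN.1 x hx
      rw [norm_smul, Real.norm_ofNat]
      linarith
    · simp only [Finset.mem_image, forall_exists_index, and_imp]
      rintro _ x hx rfl _ y hy rfl hne
      have := hN.2 x hx y hy fun h => hne (by rw [h])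
      rw [← smul_sub, norm_smul, Real.norm_ofNat]
      linarith
  obtain ⟨m, ⟨N, hN, hm⟩, hmax⟩ : ∃ m, (∃ N, P N ∧ N.card = m) ∧
      ∀ m', (∃ N, P N ∧ N.card = m') → m' ≤ m := by
    have hne : ∃ m, ∃ N, P N ∧ N.card = m := ⟨0, ∅, by simp [P], rfl⟩
    have hb : ∀ m, (∃ N, P N ∧ N.card = m) → m ≤ 5 ^ Module.finrank ℝ E := by
      rintro m ⟨N, hN, rfl⟩
      exact hcard N hN
    exact ⟨_, Nat.findGreatest_spec (P := fun m => ∃ N, P N ∧ N.card = m)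
      (hb _ hne.choose_spec) hne.choose_spec,
      fun m' h => Nat.le_findGreatest (hb m' h) h⟩
  refine ⟨N, hcard N hN, hN.1, fun x hx => ?_⟩
  by_contra! hcon
  have hxN : x ∉ N := fun h => by
    have := hcon x h
    norm_num at this
  have hP : P (insert x N) := by
    refine ⟨?_, ?_⟩
    · intro y hy
      rcases Finset.mem_insert.1 hy with rfl | hy
      · exact hx
      · exact hN.1 y hy
    · intro y hy z hz hyz
      rcases Finset.mem_insert.1 hy with rfl | hy' <;> rcases Finset.mem_insert.1 hz with rfl | hz'
      · exact absurd rfl hyz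
      · exact hcon z hz'
      · rw [norm_sub_rev]
        exact hcon y hy'
      · exact hN.2 y hy' z hz' hyz
  have := hmax _ ⟨_, hP, rfl⟩
  rw [Finset.card_insert_of_notMem hxN] at this
  omega

/-- A linear functional bounded on a `1/2`-net of the unit ball is bounded on the unit ball. -/
theorem abs_le_of_half_net {E : Type*} [NormedAddCommGroup E] [NormedSpace ℝ E]
    [FiniteDimensional ℝ E] {N : Finset E}
    (hN : ∀ x : E, ‖x‖ ≤ 1 → ∃ y ∈ N, ‖x - y‖ < 1 / 2) (f : E →ₗ[ℝ] ℝ) {s : ℝ}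
    (hs : ∀ x ∈ N, |f x| ≤ s) (x : E) : |f x| ≤ 2 * s * ‖x‖ := by
  let g : E →L[ℝ] ℝ := LinearMap.toContinuousLinearMap f
  have hs0 : 0 ≤ s := by
    obtain ⟨y, hy, -⟩ := hN 0 (by simp)
    exact (abs_nonneg _).trans (hs y hy)
  -- The error of approximating by the net is at most half the operator norm, and is absorbed on the
  -- left.
  have hg : ‖g‖ ≤ s + ‖g‖ / 2 := by
    refine g.opNorm_le_of_unit_norm (by positivity) fun z hz => ?_
    obtain ⟨y, hy, hzy⟩ := hN z hz.le
    have h1 : g z = g y + g (z - y) := by rw [map_sub]; ring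
    have h2 := g.le_opNorm (z - y)
    have h3 : ‖g‖ * ‖z - y‖ ≤ ‖g‖ * (1 / 2) := by gcongr
    have h4 : ‖g y‖ ≤ s := hs y hy
    calc ‖g z‖ ≤ ‖g y‖ + ‖g (z - y)‖ := by rw [h1]; exact norm_add_le _ _
      _ ≤ s + ‖g‖ / 2 := by linarith
  have h := g.le_opNorm x
  have h5 : ‖g‖ * ‖x‖ ≤ 2 * s * ‖x‖ := by
    gcongr
    linarith
  exact h.trans h5

/-- `Fin n → ℝ` carries the sup norm, so the Euclidean norm is written out and the net is recorded
through its effect on linear functionals. -/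
theorem exists_net (n : ℕ) :
    ∃ N : Finset (Fin n → ℝ), N.card ≤ 5 ^ n ∧ (∀ x ∈ N, ∑ i, x i ^ 2 ≤ 1) ∧
      ∀ (f : (Fin n → ℝ) →ₗ[ℝ] ℝ) (s : ℝ), (∀ x ∈ N, |f x| ≤ s) →
        ∀ x, |f x| ≤ 2 * s * Real.sqrt (∑ i, x i ^ 2) := by
  classical
  obtain ⟨N, hc, h1, hN⟩ := exists_half_net (EuclideanSpace ℝ (Fin n))
  let φ := EuclideanSpace.equiv (Fin n) ℝ
  have hnorm : ∀ x : EuclideanSpace ℝ (Fin n), ‖x‖ = Real.sqrt (∑ i, φ x i ^ 2) := by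
    intro x
    rw [EuclideanSpace.norm_eq]
    simp [φ]
  refine ⟨N.image φ, ?_, ?_, ?_⟩
  · refine Finset.card_image_le.trans ?_
    simpa using hc
  · simp only [Finset.mem_image, forall_exists_index, and_imp]
    rintro _ x hx rfl
    have := h1 x hx
    rw [hnorm, Real.sqrt_le_iff] at this
    simpa using this.2
  · intro f s hs x
    have := abs_le_of_half_net hN (f.comp φ.toLinearEquiv.toLinearMap) (s := s)
      (fun y hy => hs _ (Finset.mem_image_of_mem φ hy)) (φ.symm x)
    rw [hnorm] at this
    simpa using this

theorem multilinear_abs_le_of_net {K : ℕ} {p : Fin K → ℕ} {N : ∀ k, Finset (Fin (p k) → ℝ)}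
    (hN : ∀ k, ∀ (f : (Fin (p k) → ℝ) →ₗ[ℝ] ℝ) (s : ℝ), (∀ x ∈ N k, |f x| ≤ s) →
        ∀ x, |f x| ≤ 2 * s * Real.sqrt (∑ i, x i ^ 2))
    (f : MultilinearMap ℝ (fun k => Fin (p k) → ℝ) ℝ) {s : ℝ}
    (hs : ∀ b, (∀ k, b k ∈ N k) → |f b| ≤ s) (b : ∀ k, Fin (p k) → ℝ) :
    |f b| ≤ 2 ^ K * s * ∏ k, Real.sqrt (∑ i, b k i ^ 2) := by
  classical
  -- `J` is the set of arguments already released from their nets; releasing one more costs a factor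
  -- 2, by linearity in that argument.
  have key : ∀ J : Finset (Fin K), ∀ b : ∀ k, Fin (p k) → ℝ, (∀ k, k ∉ J → b k ∈ N k) →
      |f b| ≤ 2 ^ J.card * s * ∏ k ∈ J, Real.sqrt (∑ i, b k i ^ 2) := by
    intro J
    induction J using Finset.induction_on with
    | empty => intro b hb; simpa using hs b fun k => hb k (Finset.notMem_empty k)
    | insert k J hk ih =>
      intro b hb
      have h := hN k (f.toLinearMap b k)
        (2 ^ J.card * s * ∏ j ∈ J, Real.sqrt (∑ i, b j i ^ 2)) (fun x hx => by
          have h1 := ih (Function.update b k x) (fun j hj => by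
            by_cases hjk : j = k
            · subst hjk; simpa using hx
            · rw [Function.update_of_ne hjk]
              exact hb j (by simp [hjk, hj]))
          have h2 : ∏ j ∈ J, Real.sqrt (∑ i, Function.update b k x j i ^ 2)
              = ∏ j ∈ J, Real.sqrt (∑ i, b j i ^ 2) := by
            refine Finset.prod_congr rfl fun j hj => ?_
            rw [Function.update_of_ne (by rintro rfl; exact hk hj)]
          rw [h2] at h1
          simpa using h1) (b k)
      rw [MultilinearMap.toLinearMap_apply, Function.update_eq_self] at h
      rw [Finset.card_insert_of_notMem hk, Finset.prod_insert hk, pow_succ]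
      calc _ ≤ _ := h
        _ = _ := by ring
  simpa using key Finset.univ b (fun k hk => absurd (Finset.mem_univ k) hk)

/-- The multilinear form `∑ t, ∑ i, u t * (b₁)_{i₁} ⋯ (b_K)_{i_K} * x t i` of an array `x`. -/
noncomputable def arrayForm {K T : ℕ} {p : Fin K → ℕ} (x : Fin T → Tensor p) (u : Fin T → ℝ)
    (b : ∀ k, Fin (p k) → ℝ) : ℝ :=
  ∑ t, ∑ i, u t * (∏ k, b k (i k)) * x t i

theorem arrayForm_abs_le_of_net {K T : ℕ} {p : Fin K → ℕ} {M : Finset (Fin T → ℝ)}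
    {N : ∀ k, Finset (Fin (p k) → ℝ)}
    (hM : ∀ (f : (Fin T → ℝ) →ₗ[ℝ] ℝ) (s : ℝ), (∀ x ∈ M, |f x| ≤ s) →
        ∀ x, |f x| ≤ 2 * s * Real.sqrt (∑ i, x i ^ 2))
    (hN : ∀ k, ∀ (f : (Fin (p k) → ℝ) →ₗ[ℝ] ℝ) (s : ℝ), (∀ x ∈ N k, |f x| ≤ s) →
        ∀ x, |f x| ≤ 2 * s * Real.sqrt (∑ i, x i ^ 2))
    (x : Fin T → Tensor p) {s : ℝ}
    (hs : ∀ u ∈ M, ∀ b, (∀ k, b k ∈ N k) → |arrayForm x u b| ≤ s)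
    (u : Fin T → ℝ) (b : ∀ k, Fin (p k) → ℝ) :
    |arrayForm x u b| ≤ 2 ^ (K + 1) * s * Real.sqrt (∑ t, u t ^ 2) *
      ∏ k, Real.sqrt (∑ i, b k i ^ 2) := by
  have h1 : ∀ u ∈ M, ∀ b : ∀ k, Fin (p k) → ℝ,
      |arrayForm x u b| ≤ 2 ^ K * s * ∏ k, Real.sqrt (∑ i, b k i ^ 2) := by
    intro u hu b
    let f : MultilinearMap ℝ (fun k => Fin (p k) → ℝ) ℝ :=
      ∑ t, ∑ i : (∀ k, Fin (p k)), (u t * x t i) •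
        (MultilinearMap.mkPiAlgebra ℝ (Fin K) ℝ).compLinearMap
          fun k => LinearMap.proj (i k)
    have hf : ∀ b, f b = arrayForm x u b := by
      intro b
      simp only [f, arrayForm, _root_.sum_apply, _root_.smul_apply,
        MultilinearMap.compLinearMap_apply, MultilinearMap.mkPiAlgebra_apply,
        LinearMap.proj_apply, smul_eq_mul]
      refine Finset.sum_congr rfl fun t _ => Finset.sum_congr rfl fun i _ => by ring
    have := multilinear_abs_le_of_net hN f (s := s) (fun b hb => by
      rw [hf]; exact hs u hu b hb) b
    rwa [hf] at this
  let g : (Fin T → ℝ) →ₗ[ℝ] ℝ :=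
    ∑ t, (∑ i, (∏ k, b k (i k)) * x t i) • LinearMap.proj t
  have hg : ∀ u, g u = arrayForm x u b := by
    intro u
    simp only [g, arrayForm, LinearMap.sum_apply, LinearMap.smul_apply, LinearMap.proj_apply,
      smul_eq_mul, Finset.sum_mul]
    refine Finset.sum_congr rfl fun t _ => Finset.sum_congr rfl fun i _ => by ring
  have := hM g _ (fun u hu => by rw [hg]; exact h1 u hu b) u
  rw [hg] at this
  calc _ ≤ _ := this
    _ = _ := by ring

/-! ### The Huber function -/

/-- Tangent inequality for the concave function `z ↦ H_τ(√z)` at `z = x²`. The slope gives `w =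
min(1, τ / x)`; the bound `τ / (τ + x) ≤ w` serves both regimes at once. -/
theorem huber_sub_huber_ge {τ x y : ℝ} (hτ : 0 < τ) (hx : 0 ≤ x) (hy : 0 ≤ y) :
    ∃ w : ℝ, 0 ≤ w ∧ w ≤ 1 ∧ τ / (τ + x) ≤ w ∧
      w / 2 * (x ^ 2 - y ^ 2) ≤ huber τ x - huber τ y := by
  have hquad : huber τ y ≤ y ^ 2 / 2 := by
    unfold huber
    split_ifs with h
    · exact le_rfl
    · rw [abs_of_nonneg hy]
      nlinarith [sq_nonneg (y - τ)]
  by_cases hxτ : x ≤ τ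
  · refine ⟨1, zero_le_one, le_rfl, (div_le_one (by positivity)).2 (by linarith), ?_⟩
    have : huber τ x = x ^ 2 / 2 := by
      unfold huber
      rw [abs_of_nonneg hx, if_pos hxτ]
    linarith
  · push Not at hxτ
    have hx0 : 0 < x := hτ.trans hxτ
    refine ⟨τ / x, by positivity, (div_le_one hx0).2 hxτ.le, by gcongr; linarith, ?_⟩
    have hhx : huber τ x = τ * x - τ ^ 2 / 2 := by
      unfold huber
      rw [abs_of_nonneg hx, if_neg (not_le.2 hxτ)]
    have hw : τ / x / 2 * (x ^ 2 - y ^ 2) = τ * x / 2 - τ / x * y ^ 2 / 2 := by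
      field_simp
    rw [hhx, hw]
    unfold huber
    rw [abs_of_nonneg hy]
    split_ifs with h
    · have h1 : (x - τ) / x * y ^ 2 ≤ (x - τ) / x * (τ * x) := by
        have : 0 ≤ (x - τ) / x := div_nonneg (by linarith) hx
        have : y ^ 2 ≤ τ * x := by nlinarith
        gcongr
      have h2 : (x - τ) / x * y ^ 2 = y ^ 2 - τ / x * y ^ 2 := by field_simp
      have h3 : (x - τ) / x * (τ * x) = τ * x - τ ^ 2 := by field_simp
      nlinarith
    · have h1 : 0 ≤ τ / x * (x - y) ^ 2 := by positivity
      have h2 : τ / x * (x - y) ^ 2 = τ * x - 2 * τ * y + τ / x * y ^ 2 := by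
        field_simp
        ring
      nlinarith


/-! ### Tucker products -/

section Tucker

variable {K : ℕ} {p q r : Fin K → ℕ}

theorem tucker_tucker (F : Tensor r) (C : ∀ k, Matrix (Fin (q k)) (Fin (r k)) ℝ)
    (B : ∀ k, Matrix (Fin (p k)) (Fin (q k)) ℝ) :
    tucker (tucker F C) B = tucker F fun k => B k * C k := by
  classical
  funext i
  simp only [tucker, Matrix.mul_apply, Finset.prod_univ_sum, Fintype.piFinset_univ,
    Finset.sum_mul, Finset.mul_sum]
  rw [Finset.sum_comm]
  refine Finset.sum_congr rfl fun j _ => Finset.sum_congr rfl fun m _ => ?_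
  rw [Finset.prod_mul_distrib]
  ring

theorem tucker_sub (F G : Tensor r) (A : ∀ k, Matrix (Fin (p k)) (Fin (r k)) ℝ) :
    tucker (F - G) A = tucker F A - tucker G A := by
  funext i
  simp [tucker, sub_mul, Finset.sum_sub_distrib]

theorem tucker_smul_one (F : Tensor r) (c : Fin K → ℝ) :
    tucker F (fun k => c k • (1 : Matrix (Fin (r k)) (Fin (r k)) ℝ)) = (∏ k, c k) • F := by
  classical
  funext i
  simp only [tucker, Matrix.smul_apply, smul_eq_mul, Finset.prod_mul_distrib, Pi.smul_apply]
  rw [Finset.sum_eq_single i]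
  · simp [mul_comm]
  · intro j _ hj
    obtain ⟨k, hk⟩ := Function.ne_iff.1 hj
    rw [Finset.prod_eq_zero (f := fun k => (1 : Matrix (Fin (r k)) (Fin (r k)) ℝ) (i k) (j k))
      (Finset.mem_univ k) (Matrix.one_apply_ne (Ne.symm hk))]
    simp
  · simp

theorem sum_mul_tucker (X : Tensor p) (F : Tensor r)
    (A : ∀ k, Matrix (Fin (p k)) (Fin (r k)) ℝ) :
    ∑ i, X i * tucker F A i = ∑ j, tucker X (fun k => (A k).transpose) j * F j := by
  simp only [tucker, Finset.mul_sum, Finset.sum_mul, Matrix.transpose_apply]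
  rw [Finset.sum_comm]
  refine Finset.sum_congr rfl fun j _ => Finset.sum_congr rfl fun i _ => by ring

theorem frob_nonneg (X : Tensor p) : 0 ≤ X.frob := Real.sqrt_nonneg _

theorem frob_sq (X : Tensor p) : X.frob ^ 2 = ∑ i, X i ^ 2 :=
  Real.sq_sqrt (Finset.sum_nonneg fun _ _ => sq_nonneg _)

theorem frob_sub_le (X Y : Tensor p) : (X - Y).frob ≤ X.frob + Y.frob := by
  have h : ∀ Z : Tensor p, Z.frob = ‖(WithLp.toLp 2 Z : EuclideanSpace ℝ (∀ k, Fin (p k)))‖ := by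
    intro Z
    rw [EuclideanSpace.norm_eq]
    simp [Tensor.frob]
  rw [h, h, h, WithLp.toLp_sub]
  exact norm_sub_le _ _

/-- Moving the loadings to the other side of the inner product turns them into `A_kᵀ A_k`. It is
applied with `c = 1` for orthonormal bases and with `c k = p k` for the normalised loadings. -/
theorem frob_tucker_sq (F : Tensor r) (A : ∀ k, Matrix (Fin (p k)) (Fin (r k)) ℝ) (c : Fin K → ℝ)
    (hA : ∀ k, (A k).transpose * A k = c k • (1 : Matrix (Fin (r k)) (Fin (r k)) ℝ)) :
    (tucker F A).frob ^ 2 = (∏ k, c k) * F.frob ^ 2 := by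
  rw [frob_sq, frob_sq]
  simp_rw [pow_two]
  rw [sum_mul_tucker, tucker_tucker]
  simp_rw [hA]
  rw [tucker_smul_one, Finset.mul_sum]
  refine Finset.sum_congr rfl fun j _ => ?_
  rw [Pi.smul_apply, smul_eq_mul, mul_assoc]

end Tucker

/-! ### Compression to a common small core, and the deterministic error bound -/

theorem exists_orthonormal_span {ι E : Type*} [Fintype ι] [NormedAddCommGroup E]
    [InnerProductSpace ℝ E] [FiniteDimensional ℝ E] (v : ι → E) :
    ∃ q ≤ Fintype.card ι, ∃ b : Fin q → E, Orthonormal ℝ b ∧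
      ∀ s, ∃ c : Fin q → ℝ, v s = ∑ a, c a • b a := by
  let V : Submodule ℝ E := Submodule.span ℝ (Set.range v)
  let b := stdOrthonormalBasis ℝ V
  refine ⟨Module.finrank ℝ V, finrank_range_le_card v, fun a => (b a : E),
    b.orthonormal.comp_linearIsometry V.subtypeₗᵢ, fun s => ?_⟩
  let y : V := ⟨v s, Submodule.subset_span (Set.mem_range_self s)⟩
  refine ⟨fun a => b.repr y a, ?_⟩
  have h := congrArg (fun x : V => (x : E)) (b.sum_repr y)
  simpa [y] using h.symm

/-- Two matrices of the same size factor through a common matrix with orthonormal columns. -/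
theorem exists_common_orthonormal_factor {m n : ℕ} (A A' : Matrix (Fin m) (Fin n) ℝ) :
    ∃ (q : ℕ) (B : Matrix (Fin m) (Fin q) ℝ) (C C' : Matrix (Fin q) (Fin n) ℝ),
      q ≤ 2 * n ∧ B.transpose * B = 1 ∧ A = B * C ∧ A' = B * C' := by
  classical
  obtain ⟨q, hq, b, hb, hv⟩ := exists_orthonormal_span
    (Sum.elim (fun j => (WithLp.toLp 2 fun i => A i j : EuclideanSpace ℝ (Fin m)))
      (fun j : Fin n => WithLp.toLp 2 fun i => A' i j))
  choose c hc using hv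
  refine ⟨q, Matrix.of fun i a => b a i, Matrix.of fun a j => c (Sum.inl j) a,
    Matrix.of fun a j => c (Sum.inr j) a, ?_, ?_, ?_, ?_⟩
  · simpa [two_mul] using hq
  · ext a a'
    have h := orthonormal_iff_ite.1 hb a a'
    rw [PiLp.inner_apply] at h
    rw [Matrix.mul_apply, Matrix.one_apply, ← h]
    refine Finset.sum_congr rfl fun i _ => ?_
    simp [mul_comm]
  · ext i j
    have h := congrArg (fun x : EuclideanSpace ℝ (Fin m) => x i) (hc (Sum.inl j))
    simp only [Sum.elim_inl, WithLp.ofLp_sum, Finset.sum_apply, WithLp.ofLp_smul, Pi.smul_apply,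
      smul_eq_mul] at h
    rw [Matrix.mul_apply, h]
    exact Finset.sum_congr rfl fun a _ => mul_comm _ _
  · ext i j
    have h := congrArg (fun x : EuclideanSpace ℝ (Fin m) => x i) (hc (Sum.inr j))
    simp only [Sum.elim_inr, WithLp.ofLp_sum, Finset.sum_apply, WithLp.ofLp_smul, Pi.smul_apply,
      smul_eq_mul] at h
    rw [Matrix.mul_apply, h]
    exact Finset.sum_congr rfl fun a _ => mul_comm _ _

/-- Pairing an array with a weighted difference of two low-rank arrays. -/
theorem abs_weighted_inner_le {K T : ℕ} {p r : Fin K → ℕ} (x : Fin T → Tensor p) {S : ℝ}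
    (hS0 : 0 ≤ S)
    (hS : ∀ u b, |arrayForm x u b| ≤ S * Real.sqrt (∑ t, u t ^ 2) *
      ∏ k, Real.sqrt (∑ i, b k i ^ 2))
    (θ θ₀ : Param p r T) (w : Fin T → ℝ) :
    |∑ t, w t * ∑ i, x t i * (θ.signal t - θ₀.signal t) i| ≤
      (∏ k, (2 * r k : ℝ)) * S *
        Real.sqrt (∑ t, w t ^ 2 * (θ.signal t - θ₀.signal t).frob ^ 2) := by
  choose q B C C' hq hB hC hC' using
    fun k => exists_common_orthonormal_factor (θ.A k) (θ₀.A k)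
  -- In common orthonormal bases the difference of two Tucker products is a single one, whose core
  -- `G` has at most `∏ 2 r_k` entries and the same Frobenius norm.
  let G : Fin T → Tensor q := fun t => tucker (θ.F t) C - tucker (θ₀.F t) C'
  have hD : ∀ t, θ.signal t - θ₀.signal t = tucker (G t) B := by
    intro t
    rw [tucker_sub, tucker_tucker, tucker_tucker, Param.signal, Param.signal, ← funext hC,
      ← funext hC']
  have hfrob : ∀ t, (θ.signal t - θ₀.signal t).frob ^ 2 = ∑ j, G t j ^ 2 := by
    intro t
    rw [hD, frob_tucker_sq _ _ (fun _ => 1) (fun k => by rw [hB, one_smul]), Finset.prod_const_one,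
      one_mul, frob_sq]
  have hcol : ∀ k a, ∑ i, B k i a ^ 2 = 1 := by
    intro k a
    have := congrFun (congrFun (hB k) a) a
    rw [Matrix.mul_apply, Matrix.one_apply_eq] at this
    simpa [pow_two] using this
  -- One form per core entry; the weight enters the time vector, the others are unit columns of `B`.
  have hsum : ∑ t, w t * ∑ i, x t i * (θ.signal t - θ₀.signal t) i =
      ∑ j, arrayForm x (fun t => w t * G t j) (fun k i => B k i (j k)) := by
    simp only [hD, arrayForm, tucker, Finset.mul_sum]
    conv_rhs => rw [Finset.sum_comm]
    refine Finset.sum_congr rfl fun t _ => ?_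
    rw [Finset.sum_comm]
    refine Finset.sum_congr rfl fun j _ => Finset.sum_congr rfl fun i _ => by ring
  rw [hsum]
  have hterm : ∀ j, |arrayForm x (fun t => w t * G t j) (fun k i => B k i (j k))| ≤
      S * Real.sqrt (∑ t, w t ^ 2 * (θ.signal t - θ₀.signal t).frob ^ 2) := by
    intro j
    refine (hS _ _).trans ?_
    simp only [hcol, Real.sqrt_one, Finset.prod_const_one, mul_one]
    gcongr with t
    rw [hfrob, mul_pow]
    gcongr
    exact Finset.single_le_sum (f := fun j => G t j ^ 2) (fun _ _ => sq_nonneg _)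
      (Finset.mem_univ j)
  calc _ ≤ ∑ j, |arrayForm x (fun t => w t * G t j) (fun k i => B k i (j k))| :=
        Finset.abs_sum_le_sum_abs _ _
    _ ≤ ∑ _j : (∀ k, Fin (q k)),
        S * Real.sqrt (∑ t, w t ^ 2 * (θ.signal t - θ₀.signal t).frob ^ 2) :=
        Finset.sum_le_sum fun j _ => hterm j
    _ = (∏ k, (q k : ℝ)) * S *
        Real.sqrt (∑ t, w t ^ 2 * (θ.signal t - θ₀.signal t).frob ^ 2) := by
        simp [mul_assoc]
    _ ≤ _ := by
        gcongr with k
        exact_mod_cast hq k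

/-- The deterministic error bound for a Huber estimate. -/
theorem sum_frob_sq_le {K T : ℕ} {p r : Fin K → ℕ} {τ y₀ M S : ℝ} (hτ : 0 < τ) (hy₀ : 0 ≤ y₀)
    (hM : 0 ≤ M) (hS0 : 0 ≤ S) (hT : 0 < T) (hp : 0 < ∏ k, p k) (x : Fin T → Tensor p)
    (hS : ∀ u b, |arrayForm x u b| ≤ S * Real.sqrt (∑ t, u t ^ 2) *
      ∏ k, Real.sqrt (∑ i, b k i ^ 2))
    (θ θ₀ : Param p r T)
    (hloss : huberLoss τ (fun t i => θ₀.signal t i + x t i) θ ≤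
      huberLoss τ (fun t i => θ₀.signal t i + x t i) θ₀)
    (hD : ∀ t, (θ.signal t - θ₀.signal t).frob ^ 2 ≤ (2 * M) ^ 2 * ((∏ k, p k : ℕ) : ℝ)) :
    ∑ t, (θ.signal t - θ₀.signal t).frob ^ 2 ≤
      (τ + y₀ + 2 * M) / τ * (2 * ((∏ k, (2 * r k : ℝ)) * S)) ^ 2 +
      (2 * M) ^ 2 * ((∏ k, p k : ℕ) : ℝ) *
        (Finset.univ.filter fun t =>
          y₀ ^ 2 * ((∏ k, p k : ℕ) : ℝ) < ∑ i, x t i ^ 2).card := by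
  classical
  set P : ℝ := ((∏ k, p k : ℕ) : ℝ) with hP
  have hP0 : 0 < P := Nat.cast_pos.2 hp
  set D : Fin T → Tensor p := fun t => θ.signal t - θ₀.signal t with hDdef
  set R : ℝ := (∏ k, (2 * r k : ℝ)) * S with hR
  have hR0 : 0 ≤ R := by positivity
  have hsq : 0 < Real.sqrt P := Real.sqrt_pos.2 hP0
  choose w hw0 hw1 hwτ hw using fun t => huber_sub_huber_ge hτ
    (x := (x t - D t).frob / Real.sqrt P) (y := (x t).frob / Real.sqrt P)
    (div_nonneg (frob_nonneg _) hsq.le) (div_nonneg (frob_nonneg _) hsq.le)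
  have e1 : ∀ t, (fun i => θ₀.signal t i + x t i) - θ.signal t = x t - D t := by
    intro t; funext i; simp [hDdef]; ring
  have e2 : ∀ t, (fun i => θ₀.signal t i + x t i) - θ₀.signal t = x t := by
    intro t; funext i; simp
  have hsum : ∑ t, (huber τ ((x t - D t).frob / Real.sqrt P) -
      huber τ ((x t).frob / Real.sqrt P)) ≤ 0 := by
    unfold huberLoss at hloss
    simp only [e1, e2] at hloss
    have hT' : (0 : ℝ) < 1 / T := by positivity
    rw [Finset.sum_sub_distrib]
    exact sub_nonpos.2 (le_of_mul_le_mul_left hloss hT')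
  have hexp : ∀ t, ((x t - D t).frob / Real.sqrt P) ^ 2 - ((x t).frob / Real.sqrt P) ^ 2 =
      ((D t).frob ^ 2 - 2 * ∑ i, x t i * D t i) / P := by
    intro t
    rw [div_pow, div_pow, Real.sq_sqrt hP0.le, ← sub_div, frob_sq, frob_sq, frob_sq,
      Finset.mul_sum, ← Finset.sum_sub_distrib, ← Finset.sum_sub_distrib]
    congr 1
    refine Finset.sum_congr rfl fun i _ => ?_
    simp only [Pi.sub_apply]
    ring
  have hbasic : ∑ t, w t * (D t).frob ^ 2 ≤ 2 * ∑ t, w t * ∑ i, x t i * D t i := by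
    have h : ∑ t, w t / 2 * (((D t).frob ^ 2 - 2 * ∑ i, x t i * D t i) / P) ≤ 0 :=
      (Finset.sum_le_sum fun t _ => by rw [← hexp]; exact hw t).trans hsum
    have h' : ∑ t, w t / 2 * (((D t).frob ^ 2 - 2 * ∑ i, x t i * D t i) / P) =
        (∑ t, w t * (D t).frob ^ 2 - 2 * ∑ t, w t * ∑ i, x t i * D t i) / (2 * P) := by
      rw [Finset.mul_sum, ← Finset.sum_sub_distrib, Finset.sum_div]
      refine Finset.sum_congr rfl fun t _ => ?_
      field_simp
    rw [h', div_nonpos_iff] at h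
    rcases h with h | h <;> linarith [h.1, h.2]
  have hwD : ∑ t, w t * (D t).frob ^ 2 ≤ (2 * R) ^ 2 := by
    set Q := ∑ t, w t * (D t).frob ^ 2 with hQ
    have hQ0 : 0 ≤ Q := Finset.sum_nonneg fun t _ => mul_nonneg (hw0 t) (sq_nonneg _)
    have h1 := (le_abs_self _).trans (abs_weighted_inner_le x hS0 hS θ θ₀ w)
    have h2 : Real.sqrt (∑ t, w t ^ 2 * (D t).frob ^ 2) ≤ Real.sqrt Q := by
      refine Real.sqrt_le_sqrt (Finset.sum_le_sum fun t _ => ?_)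
      have : w t ^ 2 ≤ w t := by nlinarith [hw0 t, hw1 t]
      gcongr
    have h3 : Q ≤ 2 * R * Real.sqrt Q := by
      have : R * Real.sqrt (∑ t, w t ^ 2 * (D t).frob ^ 2) ≤ R * Real.sqrt Q := by gcongr
      linarith
    have h4 := Real.sq_sqrt hQ0
    have h5 : Real.sqrt Q ≤ 2 * R := by
      by_contra! hlt
      nlinarith [Real.sqrt_nonneg Q]
    calc Q = Real.sqrt Q ^ 2 := h4.symm
      _ ≤ _ := by gcongr
  -- If the noise at `t` is large, only the crude bound `hD` is used. Otherwise the normalised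
  -- residual is at most `y₀ + 2 * M`, which bounds the weight below.
  have hpt : ∀ t, (D t).frob ^ 2 ≤ (τ + y₀ + 2 * M) / τ * (w t * (D t).frob ^ 2) +
      (2 * M) ^ 2 * P * (if y₀ ^ 2 * P < ∑ i, x t i ^ 2 then 1 else 0) := by
    intro t
    split_ifs with h
    · have : 0 ≤ (τ + y₀ + 2 * M) / τ * (w t * (D t).frob ^ 2) := by
        have := hw0 t
        positivity
      linarith [hD t]
    · push Not at h
      have hx : (x t).frob / Real.sqrt P ≤ y₀ := by
        rw [div_le_iff₀ hsq]
        refine Real.sqrt_le_iff.2 ⟨by positivity, ?_⟩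
        rw [mul_pow, Real.sq_sqrt hP0.le]
        exact h
      have hd : (D t).frob / Real.sqrt P ≤ 2 * M := by
        rw [div_le_iff₀ hsq]
        refine le_of_sq_le_sq ?_ (by positivity)
        rw [mul_pow, Real.sq_sqrt hP0.le]
        exact hD t
      have hle : (x t - D t).frob / Real.sqrt P ≤ y₀ + 2 * M := by
        calc _ ≤ ((x t).frob + (D t).frob) / Real.sqrt P := by
              gcongr
              exact frob_sub_le _ _
          _ ≤ _ := by rw [add_div]; linarith
      have h1 : τ / (τ + y₀ + 2 * M) ≤ w t := by
        refine le_trans ?_ (hwτ t)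
        have : 0 ≤ (x t - D t).frob / Real.sqrt P := div_nonneg (frob_nonneg _) hsq.le
        exact div_le_div_of_nonneg_left hτ.le (by linarith) (by linarith)
      have h2 : 1 ≤ (τ + y₀ + 2 * M) / τ * w t := by
        have : 0 < τ + y₀ + 2 * M := by positivity
        calc (1 : ℝ) = (τ + y₀ + 2 * M) / τ * (τ / (τ + y₀ + 2 * M)) := by field_simp
          _ ≤ _ := by gcongr
      rw [mul_zero, add_zero, ← mul_assoc]
      exact le_mul_of_one_le_left (sq_nonneg _) h2
  calc ∑ t, (D t).frob ^ 2 ≤ ∑ t, ((τ + y₀ + 2 * M) / τ * (w t * (D t).frob ^ 2) +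
      (2 * M) ^ 2 * P * (if y₀ ^ 2 * P < ∑ i, x t i ^ 2 then 1 else 0)) :=
        Finset.sum_le_sum fun t _ => hpt t
    _ = (τ + y₀ + 2 * M) / τ * (∑ t, w t * (D t).frob ^ 2) + (2 * M) ^ 2 * P *
        (Finset.univ.filter fun t => y₀ ^ 2 * P < ∑ i, x t i ^ 2).card := by
        rw [Finset.sum_add_distrib, ← Finset.mul_sum, ← Finset.mul_sum, Finset.sum_boole]
    _ ≤ _ := by gcongr


/-! ### Sub-Gaussian noise -/

/-- Integrated against centred noise, the linear term vanishes and only even moments remain; the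
price is replacing `ν` by `2 * ν`. -/
theorem exp_le_add_cosh (x : ℝ) : Real.exp x ≤ x + Real.cosh (2 * x) := by
  have hc : Real.cosh (2 * x) = 1 + 2 * Real.sinh x ^ 2 := by
    rw [Real.cosh_two_mul, Real.cosh_sq]
    ring
  rw [hc]
  have habs : |x| ≤ |Real.sinh x| := by
    rw [Real.abs_sinh]
    exact Real.self_le_sinh_iff.2 (abs_nonneg x)
  have hsq : x ^ 2 ≤ Real.sinh x ^ 2 := sq_le_sq.2 habs
  rcases le_or_gt |x| 1 with h | h
  · have := (abs_le.1 (Real.abs_exp_sub_one_sub_id_le h)).2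
    nlinarith
  · rcases lt_abs.1 h with h1 | h1
    · have h2 : Real.exp x * Real.exp (-x) = 1 := by rw [← Real.exp_add]; simp
      have h3 := Real.sinh_eq x
      have h4 := sq_nonneg (Real.exp x - 1)
      have h5 := sq_nonneg (Real.exp (-x))
      rw [h3]
      nlinarith
    · have h2 : Real.exp x ≤ 1 := Real.exp_le_one_iff.2 (by linarith)
      nlinarith

/-- The factor `(2d)!` in the moment bound cancels against the cosine series, leaving the
exponential series of `ν² s² / 2`. The Lebesgue integral lets sum and integral be exchanged before
integrability is known. -/
theorem lintegral_cosh_le {Ω : Type*} [MeasurableSpace Ω] {μ : Measure Ω} [IsProbabilityMeasure μ]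
    {X : Ω → ℝ} (hX : Measurable X) {ν : ℝ}
    (hmom : ∀ d : ℕ, 1 ≤ d → Integrable (fun ω => |X ω| ^ (2 * d)) μ ∧
      ∫ ω, |X ω| ^ (2 * d) ∂μ ≤
        ((2 * d).factorial : ℝ) / (2 ^ d * (d.factorial : ℝ)) * ν ^ (2 * d)) (s : ℝ) :
    ∫⁻ ω, ENNReal.ofReal (Real.cosh (s * X ω)) ∂μ ≤
      ENNReal.ofReal (Real.exp (ν ^ 2 * s ^ 2 / 2)) := by
  have hmom' : ∀ d : ℕ, Integrable (fun ω => |X ω| ^ (2 * d)) μ ∧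
      ∫ ω, |X ω| ^ (2 * d) ∂μ ≤
        ((2 * d).factorial : ℝ) / (2 ^ d * (d.factorial : ℝ)) * ν ^ (2 * d) := by
    intro d
    rcases Nat.eq_zero_or_pos d with rfl | hd
    · simp
    · exact hmom d hd
  have hterm : ∀ d ω, 0 ≤ (s * X ω) ^ (2 * d) / ((2 * d).factorial : ℝ) := fun d ω => by
    rw [pow_mul]; positivity
  have h1 : ∀ ω, ENNReal.ofReal (Real.cosh (s * X ω)) =
      ∑' d : ℕ, ENNReal.ofReal ((s * X ω) ^ (2 * d) / ((2 * d).factorial : ℝ)) := by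
    intro ω
    rw [← (Real.hasSum_cosh (s * X ω)).tsum_eq]
    exact ENNReal.ofReal_tsum_of_nonneg (fun d => hterm d ω) (Real.hasSum_cosh (s * X ω)).summable
  simp_rw [h1]
  rw [lintegral_tsum fun d => by fun_prop]
  have h2 : ∀ d : ℕ, ∫⁻ ω, ENNReal.ofReal ((s * X ω) ^ (2 * d) / ((2 * d).factorial : ℝ)) ∂μ ≤
      ENNReal.ofReal ((ν ^ 2 * s ^ 2 / 2) ^ d / (d.factorial : ℝ)) := by
    intro d
    have he : ∀ ω, (s * X ω) ^ (2 * d) / ((2 * d).factorial : ℝ) =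
        s ^ (2 * d) / ((2 * d).factorial : ℝ) * |X ω| ^ (2 * d) := by
      intro ω
      rw [mul_pow, pow_mul |X ω|, sq_abs, ← pow_mul]
      ring
    have hi : Integrable (fun ω => (s * X ω) ^ (2 * d) / ((2 * d).factorial : ℝ)) μ := by
      simp_rw [he]
      exact (hmom' d).1.const_mul _
    rw [← ofReal_integral_eq_lintegral_ofReal hi (ae_of_all _ fun ω => hterm d ω)]
    refine ENNReal.ofReal_le_ofReal ?_
    simp_rw [he]
    rw [integral_const_mul]
    have h0 : 0 ≤ s ^ (2 * d) / ((2 * d).factorial : ℝ) := by rw [pow_mul]; positivity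
    refine (mul_le_mul_of_nonneg_left (hmom' d).2 h0).trans_eq ?_
    have : ((2 * d).factorial : ℝ) ≠ 0 := by positivity
    rw [div_pow, mul_pow, ← pow_mul, ← pow_mul]
    field_simp
  refine (ENNReal.tsum_le_tsum h2).trans_eq ?_
  have hsum := NormedSpace.expSeries_div_hasSum_exp (𝔸 := ℝ) (ν ^ 2 * s ^ 2 / 2)
  rw [← ENNReal.ofReal_tsum_of_nonneg (fun d => by positivity) hsum.summable, hsum.tsum_eq,
    Real.exp_eq_exp_ℝ]

theorem integrable_cosh {Ω : Type*} [MeasurableSpace Ω] {μ : Measure Ω} [IsProbabilityMeasure μ]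
    {X : Ω → ℝ} (hX : Measurable X) {ν : ℝ}
    (hmom : ∀ d : ℕ, 1 ≤ d → Integrable (fun ω => |X ω| ^ (2 * d)) μ ∧
      ∫ ω, |X ω| ^ (2 * d) ∂μ ≤
        ((2 * d).factorial : ℝ) / (2 ^ d * (d.factorial : ℝ)) * ν ^ (2 * d)) (s : ℝ) :
    Integrable (fun ω => Real.cosh (s * X ω)) μ ∧
      ∫ ω, Real.cosh (s * X ω) ∂μ ≤ Real.exp (ν ^ 2 * s ^ 2 / 2) := by
  have h := lintegral_cosh_le hX hmom s
  have hmeas : Measurable fun ω => Real.cosh (s * X ω) :=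
    Real.continuous_cosh.measurable.comp (hX.const_mul s)
  have h0 : ∀ ω, 0 ≤ Real.cosh (s * X ω) := fun ω => (Real.cosh_pos _).le
  have hi : Integrable (fun ω => Real.cosh (s * X ω)) μ :=
    (lintegral_ofReal_ne_top_iff_integrable hmeas.aestronglyMeasurable (ae_of_all _ h0)).1
      (h.trans_lt ENNReal.ofReal_lt_top).ne
  refine ⟨hi, ?_⟩
  rw [← ofReal_integral_eq_lintegral_ofReal hi (ae_of_all _ h0)] at h
  exact (ENNReal.ofReal_le_ofReal_iff (Real.exp_pos _).le).1 h

theorem hasSubgaussianMGF_of_moments {Ω : Type*} [MeasurableSpace Ω] {μ : Measure Ω}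
    [IsProbabilityMeasure μ] {X : Ω → ℝ} (hX : Measurable X) {ν : ℝ}
    (hmean : Integrable X μ ∧ ∫ ω, X ω ∂μ = 0)
    (hmom : ∀ d : ℕ, 1 ≤ d → Integrable (fun ω => |X ω| ^ (2 * d)) μ ∧
      ∫ ω, |X ω| ^ (2 * d) ∂μ ≤
        ((2 * d).factorial : ℝ) / (2 ^ d * (d.factorial : ℝ)) * ν ^ (2 * d)) :
    HasSubgaussianMGF X ((2 * ν) ^ 2).toNNReal μ := by
  have hle : ∀ s ω, Real.exp (s * X ω) ≤ s * X ω + Real.cosh (2 * s * X ω) := fun s ω => by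
    rw [mul_assoc]; exact exp_le_add_cosh _
  have hint : ∀ s, Integrable (fun ω => s * X ω + Real.cosh (2 * s * X ω)) μ := fun s =>
    (hmean.1.const_mul s).add (integrable_cosh hX hmom (2 * s)).1
  have hexp : ∀ s, Integrable (fun ω => Real.exp (s * X ω)) μ := fun s =>
    (hint s).mono' (by fun_prop) (ae_of_all _ fun ω => by
      rw [Real.norm_eq_abs, Real.abs_exp]; exact hle s ω)
  refine ⟨hexp, fun s => ?_⟩
  calc mgf X μ s = ∫ ω, Real.exp (s * X ω) ∂μ := rfl
    _ ≤ ∫ ω, (s * X ω + Real.cosh (2 * s * X ω)) ∂μ := integral_mono (hexp s) (hint s) (hle s)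
    _ = ∫ ω, Real.cosh (2 * s * X ω) ∂μ := by
      rw [integral_add (hmean.1.const_mul s) (integrable_cosh hX hmom (2 * s)).1,
        integral_const_mul, hmean.2, mul_zero, zero_add]
    _ ≤ _ := by
      refine (integrable_cosh hX hmom (2 * s)).2.trans_eq ?_
      rw [Real.coe_toNNReal _ (sq_nonneg _)]
      congr 1
      ring

theorem measure_abs_sum_gt_le {Ω ι : Type*} [Fintype ι] [MeasurableSpace Ω] {μ : Measure Ω}
    [IsProbabilityMeasure μ] {X : ι → Ω → ℝ} (hindep : iIndepFun X μ) {c : ℝ} (hc : 0 < c)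
    (hX : ∀ i, HasSubgaussianMGF (X i) c.toNNReal μ) (a : ι → ℝ) (ha : ∑ i, a i ^ 2 ≤ 1)
    {s : ℝ} (hs : 0 ≤ s) :
    μ {ω | s < |∑ i, a i * X i ω|} ≤ ENNReal.ofReal (2 * Real.exp (-s ^ 2 / (2 * c))) := by
  have hi : iIndepFun (fun i ω => a i * X i ω) μ :=
    hindep.comp (fun i x => a i * x) fun i => measurable_const_mul (a i)
  have hsub := HasSubgaussianMGF.sum_of_iIndepFun hi (s := Finset.univ)
    (fun i _ => (hX i).const_mul (a i))
  have hCle : ((∑ i, NNReal.mk (a i ^ 2) (sq_nonneg _) * c.toNNReal : NNReal) : ℝ) ≤ c := by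
    push_cast
    rw [← Finset.sum_mul, Real.coe_toNNReal _ hc.le]
    exact mul_le_of_le_one_left hc.le ha
  have hsub' : HasSubgaussianMGF (fun ω => ∑ i, a i * X i ω) c.toNNReal μ := by
    refine ⟨hsub.integrable_exp_mul, fun t => (hsub.mgf_le t).trans ?_⟩
    rw [Real.coe_toNNReal _ hc.le]
    gcongr
    exact hCle
  have h1 := hsub'.measure_ge_le hs
  have h2 := hsub'.neg.measure_ge_le hs
  rw [Real.coe_toNNReal _ hc.le] at h1 h2
  have hsubset : {ω | s < |∑ i, a i * X i ω|} ⊆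
      {ω | s ≤ ∑ i, a i * X i ω} ∪ {ω | s ≤ (-fun ω => ∑ i, a i * X i ω) ω} := by
    intro ω hω
    rcases lt_abs.1 (Set.mem_ofPred_eq ▸ hω) with h | h
    · exact Or.inl h.le
    · exact Or.inr h.le
  refine (measure_mono hsubset).trans ((measure_union_le _ _).trans ?_)
  rw [two_mul, ENNReal.ofReal_add (by positivity) (by positivity)]
  refine add_le_add ?_ ?_
  · rw [← ofReal_measureReal]; exact ENNReal.ofReal_le_ofReal h1
  · rw [← ofReal_measureReal]; exact ENNReal.ofReal_le_ofReal h2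

/-- Uniform bound for the multilinear form of a noise array. -/
theorem measure_arrayForm_bound {K T : ℕ} {p : Fin K → ℕ} {Ω : Type*} [MeasurableSpace Ω]
    {μ : Measure Ω} [IsProbabilityMeasure μ] {e : Fin T → (∀ k, Fin (p k)) → Ω → ℝ}
    (hindep : NoiseIndep μ e) {ν : ℝ} (hν : 0 < ν) (hsub : NoiseSubGaussian μ ν e) {s : ℝ}
    (hs : 0 ≤ s) :
    μ {ω | ¬ ∀ u b, |arrayForm (fun t i => e t i ω) u b| ≤
        2 ^ (K + 1) * s * Real.sqrt (∑ t, u t ^ 2) * ∏ k, Real.sqrt (∑ i, b k i ^ 2)} ≤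
      ENNReal.ofReal (5 ^ (T + ∑ k, p k) * (2 * Real.exp (-s ^ 2 / (2 * (2 * ν) ^ 2)))) := by
  classical
  obtain ⟨M, hMc, hM1, hM⟩ := exists_net T
  choose N hNc hN1 hN using fun k => exists_net (p k)
  -- Union bound over the product of the nets, of cardinality at most `5 ^ (T + ∑ p_k)`.
  let J : Finset ((Fin T → ℝ) × (∀ k, Fin (p k) → ℝ)) := M ×ˢ Fintype.piFinset N
  have hsubset : {ω | ¬ ∀ u b, |arrayForm (fun t i => e t i ω) u b| ≤
        2 ^ (K + 1) * s * Real.sqrt (∑ t, u t ^ 2) * ∏ k, Real.sqrt (∑ i, b k i ^ 2)} ⊆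
      ⋃ x ∈ J, {ω | s < |arrayForm (fun t i => e t i ω) x.1 x.2|} := by
    intro ω hω
    by_contra hcon
    refine hω (arrayForm_abs_le_of_net hM hN _ fun u hu b hb => ?_)
    by_contra! hlt
    exact hcon (Set.mem_biUnion (x := (u, b))
      (Finset.mem_product.2 ⟨hu, Fintype.mem_piFinset.2 hb⟩) hlt)
  have hpoint : ∀ x ∈ J, μ {ω | s < |arrayForm (fun t i => e t i ω) x.1 x.2|} ≤
      ENNReal.ofReal (2 * Real.exp (-s ^ 2 / (2 * (2 * ν) ^ 2))) := by
    rintro ⟨u, b⟩ hx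
    obtain ⟨hu, hb⟩ := Finset.mem_product.1 hx
    have hb := Fintype.mem_piFinset.1 hb
    have h := measure_abs_sum_gt_le hindep.indep (c := (2 * ν) ^ 2) (by positivity)
      (fun ti => hasSubgaussianMGF_of_moments (hindep.measurable ti.1 ti.2)
        (hsub.mean_zero ti.1 ti.2) (hsub.moments ti.1 ti.2))
      (fun ti => u ti.1 * ∏ k, b k (ti.2 k)) ?_ hs
    · simpa only [arrayForm, Fintype.sum_prod_type] using h
    · have h1 : ∑ i : (∀ k, Fin (p k)), ∏ k, b k (i k) ^ 2 = ∏ k, ∑ a, b k a ^ 2 := by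
        rw [Finset.prod_univ_sum, Fintype.piFinset_univ]
      simp only [mul_pow, ← Finset.prod_pow]
      rw [Fintype.sum_prod_type]
      simp only [← Finset.mul_sum, ← Finset.sum_mul]
      rw [h1]
      exact mul_le_one₀ (hM1 u hu) (Finset.prod_nonneg fun _ _ =>
        Finset.sum_nonneg fun _ _ => sq_nonneg _) (Finset.prod_le_one
          (fun _ _ => Finset.sum_nonneg fun _ _ => sq_nonneg _) fun k _ => hN1 k _ (hb k))
  have hcard : (J.card : ℝ) ≤ 5 ^ (T + ∑ k, p k) := by
    have : J.card ≤ 5 ^ (T + ∑ k, p k) := by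
      rw [Finset.card_product, Fintype.card_piFinset, pow_add, ← Finset.prod_pow_eq_pow_sum]
      exact Nat.mul_le_mul hMc (Finset.prod_le_prod' fun k _ => hNc k)
    exact_mod_cast this
  calc _ ≤ μ (⋃ x ∈ J, {ω | s < |arrayForm (fun t i => e t i ω) x.1 x.2|}) :=
        measure_mono hsubset
    _ ≤ ∑ x ∈ J, μ {ω | s < |arrayForm (fun t i => e t i ω) x.1 x.2|} :=
        measure_biUnion_finset_le _ _
    _ ≤ ∑ x ∈ J, ENNReal.ofReal (2 * Real.exp (-s ^ 2 / (2 * (2 * ν) ^ 2))) :=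
        Finset.sum_le_sum hpoint
    _ = ENNReal.ofReal (J.card * (2 * Real.exp (-s ^ 2 / (2 * (2 * ν) ^ 2)))) := by
        rw [Finset.sum_const, nsmul_eq_mul, ENNReal.ofReal_mul (Nat.cast_nonneg _),
          ENNReal.ofReal_natCast]
    _ ≤ _ := by gcongr


/-! ### Number of large noise tensors -/

/-- Chebyshev: the mean is at most `ν² p` and the variance at most `3 ν⁴ p`, from the second and
fourth moments, while the threshold `4 ν² p` exceeds the mean by more than `ν² p`. -/
theorem measure_sum_sq_gt_le {K T : ℕ} {p : Fin K → ℕ} {Ω : Type*} [MeasurableSpace Ω]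
    {μ : Measure Ω} [IsProbabilityMeasure μ] {e : Fin T → (∀ k, Fin (p k)) → Ω → ℝ}
    (hindep : NoiseIndep μ e) {ν : ℝ} (hν : 0 < ν) (hsub : NoiseSubGaussian μ ν e)
    (hp : 0 < ∏ k, p k) (t : Fin T) :
    μ {ω | (2 * ν) ^ 2 * ((∏ k, p k : ℕ) : ℝ) < ∑ i, e t i ω ^ 2} ≤
      ENNReal.ofReal (3 / ((∏ k, p k : ℕ) : ℝ)) := by
  classical
  have hcard : (Fintype.card (∀ k, Fin (p k)) : ℝ) = ((∏ k, p k : ℕ) : ℝ) := by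
    simp
  set P : ℝ := ((∏ k, p k : ℕ) : ℝ) with hP
  have hP0 : 0 < P := Nat.cast_pos.2 hp
  have hm := fun i => hindep.measurable t i
  have h2 : ∀ i, Integrable (fun ω => e t i ω ^ 2) μ ∧ ∫ ω, e t i ω ^ 2 ∂μ ≤ ν ^ 2 := by
    intro i
    have h := hsub.moments t i 1 le_rfl
    norm_num [Nat.factorial] at h
    exact h
  have h4 : ∀ i, Integrable (fun ω => (e t i ω ^ 2) ^ 2) μ ∧
      ∫ ω, (e t i ω ^ 2) ^ 2 ∂μ ≤ 3 * ν ^ 4 := by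
    intro i
    have h := hsub.moments t i 2 one_le_two
    have he : ∀ ω, |e t i ω| ^ (2 * 2) = (e t i ω ^ 2) ^ 2 := fun ω => by
      rw [pow_mul, sq_abs]
    simp only [he] at h
    norm_num [Nat.factorial] at h
    simpa using h
  have hL : ∀ i, MemLp (fun ω => e t i ω ^ 2) 2 μ := fun i =>
    (memLp_two_iff_integrable_sq ((hm i).pow_const 2).aestronglyMeasurable).2 (h4 i).1
  let Y : Ω → ℝ := ∑ i, fun ω => e t i ω ^ 2
  have hY : ∀ ω, Y ω = ∑ i, e t i ω ^ 2 := fun ω => by simp [Y]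
  have hYL : MemLp Y 2 μ := memLp_finsetSum' _ fun i _ => hL i
  have hvar : variance Y μ ≤ 3 * ν ^ 4 * P := by
    rw [IndepFun.variance_sum (fun i _ => hL i) (fun i _ j _ hij =>
      (hindep.indep.indepFun (i := (t, i)) (j := (t, j)) (by simpa using hij)).comp
        (φ := fun x : ℝ => x ^ 2) (ψ := fun x : ℝ => x ^ 2) (by fun_prop) (by fun_prop))]
    calc _ ≤ ∑ _i : (∀ k, Fin (p k)), 3 * ν ^ 4 := by
          refine Finset.sum_le_sum fun i _ => ?_
          exact (variance_le_expectation_sq ((hm i).pow_const 2).aestronglyMeasurable).trans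
            (h4 i).2
      _ = _ := by rw [Finset.sum_const, nsmul_eq_mul, Finset.card_univ, hcard, mul_comm]
  have hmean : ∫ ω, Y ω ∂μ ≤ ν ^ 2 * P := by
    simp only [hY]
    rw [integral_finsetSum _ fun i _ => (h2 i).1]
    calc _ ≤ ∑ _i : (∀ k, Fin (p k)), ν ^ 2 := Finset.sum_le_sum fun i _ => (h2 i).2
      _ = _ := by rw [Finset.sum_const, nsmul_eq_mul, Finset.card_univ, hcard, mul_comm]
  have hc : 0 < ν ^ 2 * P := by positivity
  refine (measure_mono ?_).trans ((meas_ge_le_variance_div_sq hYL hc).trans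
    (ENNReal.ofReal_le_ofReal ?_))
  · intro ω hω
    have hω : (2 * ν) ^ 2 * P < ∑ i, e t i ω ^ 2 := hω
    rw [← hY] at hω
    show ν ^ 2 * P ≤ |Y ω - ∫ ω, Y ω ∂μ|
    refine le_trans ?_ (le_abs_self _)
    nlinarith
  · rw [div_le_div_iff₀ (by positivity) hP0]
    calc variance Y μ * P ≤ 3 * ν ^ 4 * P * P := by gcongr
      _ = _ := by ring

/-- The expected number of such `t` is at most `3 T / p`; Markov's inequality finishes. -/
theorem measure_card_large_gt_le {K T : ℕ} {p : Fin K → ℕ} {Ω : Type*} [MeasurableSpace Ω]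
    {μ : Measure Ω} [IsProbabilityMeasure μ] {e : Fin T → (∀ k, Fin (p k)) → Ω → ℝ}
    (hindep : NoiseIndep μ e) {ν : ℝ} (hν : 0 < ν) (hsub : NoiseSubGaussian μ ν e)
    (hT : 0 < T) (hp : 0 < ∏ k, p k) {c : ℝ} (hc : 0 < c) :
    μ {ω | c * (T / ((∏ k, p k : ℕ) : ℝ)) < (Finset.univ.filter fun t =>
        (2 * ν) ^ 2 * ((∏ k, p k : ℕ) : ℝ) < ∑ i, e t i ω ^ 2).card} ≤
      ENNReal.ofReal (3 / c) := by
  classical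
  have hpt := fun t => measure_sum_sq_gt_le hindep hν hsub hp t
  set P : ℝ := ((∏ k, p k : ℕ) : ℝ) with hP
  have hP0 : 0 < P := Nat.cast_pos.2 hp
  have hT0 : (0 : ℝ) < T := Nat.cast_pos.2 hT
  let B : Fin T → Set Ω := fun t => {ω | (2 * ν) ^ 2 * P < ∑ i, e t i ω ^ 2}
  have hB : ∀ t, MeasurableSet (B t) := fun t => measurableSet_lt measurable_const
    (Finset.measurable_sum _ fun i _ => (hindep.measurable t i).pow_const 2)
  let f : Ω → ENNReal := fun ω => ∑ t, (B t).indicator 1 ω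
  have hf : Measurable f := Finset.measurable_sum _ fun t _ => measurable_one.indicator (hB t)
  have hfint : ∫⁻ ω, f ω ∂μ ≤ ENNReal.ofReal (T * (3 / P)) := by
    rw [lintegral_finsetSum _ fun t _ => measurable_one.indicator (hB t)]
    simp only [lintegral_indicator_one (hB _)]
    refine (Finset.sum_le_sum fun t _ => hpt t).trans_eq ?_
    rw [Finset.sum_const, nsmul_eq_mul, Finset.card_univ, Fintype.card_fin,
      ENNReal.ofReal_mul hT0.le, ENNReal.ofReal_natCast]
  have hfcard : ∀ ω, f ω = ENNReal.ofReal ((Finset.univ.filter fun t =>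
      (2 * ν) ^ 2 * P < ∑ i, e t i ω ^ 2).card : ℝ) := by
    intro ω
    rw [ENNReal.ofReal_natCast, ← Finset.sum_boole]
    rfl
  have hpos : 0 < c * (T / P) := by positivity
  refine (measure_mono (t := {ω | ENNReal.ofReal (c * (T / P)) ≤ f ω}) fun ω hω => ?_).trans
    ((meas_ge_le_lintegral_div hf.aemeasurable (by simpa using hpos) ENNReal.ofReal_ne_top).trans ?_)
  · show _ ≤ f ω
    rw [hfcard]
    exact ENNReal.ofReal_le_ofReal (le_of_lt hω)
  · refine (ENNReal.div_le_div_right hfint _).trans_eq ?_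
    rw [← ENNReal.ofReal_div_of_pos hpos]
    congr 1
    field_simp

/-! ### Assembly -/

theorem prod_eq_mul_coDim {K : ℕ} (p : Fin K → ℕ) (k : Fin K) :
    ∏ j, p j = p k * coDim p k :=
  (Finset.mul_prod_erase _ _ (Finset.mem_univ k)).symm

/-- `T / (T p) = 1 / p` and `p_k / (T p) = 1 / (T p_{-k})`: `K + 1` terms, each at most `1 / L*`. -/
theorem dims_div_le {K : ℕ} [NeZero K] {T : ℕ} {p : Fin K → ℕ} (hT : 0 < T)
    (hp : ∀ k, 0 < p k) :
    ((T + ∑ k, p k : ℕ) : ℝ) / (T * ((∏ k, p k : ℕ) : ℝ)) ≤ (K + 1) * (1 / (Lstar T p : ℝ)) ∧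
      1 / ((∏ k, p k : ℕ) : ℝ) ≤ 1 / (Lstar T p : ℝ) := by
  have hP : 0 < ∏ k, p k := Finset.prod_pos fun k _ => hp k
  have hcd : ∀ k, 0 < coDim p k := fun k => Finset.prod_pos fun j _ => hp j
  have hL0 : 0 < Lstar T p := by
    refine lt_min hP (lt_min ?_ ?_)
    · exact (Finset.lt_inf'_iff _).2 fun k _ => pow_pos (hcd k) 2
    · exact (Finset.lt_inf'_iff _).2 fun k _ => Nat.mul_pos hT (hcd k)
  have hLP : Lstar T p ≤ ∏ k, p k := min_le_left _ _
  have hLk : ∀ k, Lstar T p ≤ T * coDim p k := fun k =>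
    (min_le_right _ _).trans ((min_le_right _ _).trans (Finset.inf'_le _ (Finset.mem_univ k)))
  have hL0' : (0 : ℝ) < Lstar T p := Nat.cast_pos.2 hL0
  have hP' : (0 : ℝ) < ((∏ k, p k : ℕ) : ℝ) := Nat.cast_pos.2 hP
  have hT' : (0 : ℝ) < T := Nat.cast_pos.2 hT
  have h1 : 1 / ((∏ k, p k : ℕ) : ℝ) ≤ 1 / (Lstar T p : ℝ) :=
    one_div_le_one_div_of_le hL0' (by exact_mod_cast hLP)
  refine ⟨?_, h1⟩
  have h2 : ∀ k, (p k : ℝ) / (T * ((∏ k, p k : ℕ) : ℝ)) ≤ 1 / (Lstar T p : ℝ) := by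
    intro k
    have hpk : (0 : ℝ) < p k := Nat.cast_pos.2 (hp k)
    have hck : (0 : ℝ) < coDim p k := Nat.cast_pos.2 (hcd k)
    have h3 : (Lstar T p : ℝ) ≤ T * coDim p k := by exact_mod_cast hLk k
    calc (p k : ℝ) / (T * ((∏ k, p k : ℕ) : ℝ)) = 1 / (T * coDim p k) := by
          rw [prod_eq_mul_coDim p k, Nat.cast_mul]
          field_simp
      _ ≤ _ := one_div_le_one_div_of_le hL0' h3
  rw [Nat.cast_add, Nat.cast_sum, add_div, Finset.sum_div]
  have h4 : (T : ℝ) / (T * ((∏ k, p k : ℕ) : ℝ)) = 1 / ((∏ k, p k : ℕ) : ℝ) := by field_simp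
  calc _ ≤ 1 / (Lstar T p : ℝ) + ∑ _k : Fin K, 1 / (Lstar T p : ℝ) := by
        rw [h4]
        exact add_le_add h1 (Finset.sum_le_sum fun k _ => h2 k)
    _ = _ := by
        rw [Finset.sum_const, Finset.card_univ, Fintype.card_fin, nsmul_eq_mul]
        ring

theorem exists_frob_le {K : ℕ} {r : Fin K → ℕ} {ℱ : Set (Tensor r)}
    (h : Bornology.IsBounded ℱ) : ∃ M, 0 ≤ M ∧ ∀ F ∈ ℱ, F.frob ≤ M := by
  obtain ⟨M, hM0, hM⟩ := h.exists_pos_norm_le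
  refine ⟨Real.sqrt (∑ _i : (∀ k, Fin (r k)), M ^ 2), Real.sqrt_nonneg _, fun F hF => ?_⟩
  refine Real.sqrt_le_sqrt (Finset.sum_le_sum fun i _ => sq_le_sq.2 ?_)
  rw [abs_of_pos hM0]
  exact (norm_le_pi_norm F i).trans (hM F hF)

theorem frob_signal_sub_sq_le {K : ℕ} {r p : Fin K → ℕ} {T : ℕ} {𝒜 : ∀ k, Set (Fin (r k) → ℝ)}
    {ℱ : Set (Tensor r)} {M : ℝ} (hM : ∀ F ∈ ℱ, F.frob ≤ M) (hp : ∀ k, 0 < p k)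
    {θ θ' : Param p r T} (hθ : θ ∈ paramSpace 𝒜 ℱ p T) (hθ' : θ' ∈ paramSpace 𝒜 ℱ p T)
    (t : Fin T) :
    (θ.signal t - θ'.signal t).frob ^ 2 ≤ (2 * M) ^ 2 * ((∏ k, p k : ℕ) : ℝ) := by
  have hM0 : 0 ≤ M := (frob_nonneg _).trans (hM _ (hθ.2.2.1 t))
  have hP : (0 : ℝ) ≤ ((∏ k, p k : ℕ) : ℝ) := Nat.cast_nonneg _
  have key : ∀ η ∈ paramSpace 𝒜 ℱ p T,
      (Param.signal η t).frob ≤ Real.sqrt ((∏ k, p k : ℕ) : ℝ) * M := by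
    intro η hη
    refine le_of_sq_le_sq ?_ (by positivity)
    rw [Param.signal, frob_tucker_sq _ _ (fun k => (p k : ℝ)) (fun k => ?_), mul_pow,
      Real.sq_sqrt hP, Nat.cast_prod]
    · gcongr
      · exact frob_nonneg _
      · exact hM _ (hη.2.2.1 t)
    · have hk : (p k : ℝ) ≠ 0 := Nat.cast_ne_zero.2 (hp k).ne'
      rw [← hη.2.1 k, smul_smul, mul_one_div_cancel hk, one_smul]
  calc (θ.signal t - θ'.signal t).frob ^ 2
      ≤ (Real.sqrt ((∏ k, p k : ℕ) : ℝ) * M + Real.sqrt ((∏ k, p k : ℕ) : ℝ) * M) ^ 2 := by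
        gcongr
        · exact frob_nonneg _
        · exact (frob_sub_le _ _).trans (add_le_add (key _ hθ) (key _ hθ'))
    _ = (2 * M) ^ 2 * Real.sqrt ((∏ k, p k : ℕ) : ℝ) ^ 2 := by ring
    _ = _ := by rw [Real.sq_sqrt hP]

/-- The union bound over the nets at the chosen level. -/
theorem net_tail_le {m : ℕ} {ν s : ℝ} (hν : 0 < ν) (hs : s ^ 2 = 24 * ν ^ 2 * m) :
    5 ^ m * (2 * Real.exp (-s ^ 2 / (2 * (2 * ν) ^ 2))) ≤ 2 * Real.exp (-(m : ℝ)) := by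
  -- The constant 24 makes the exponent `-3m`; the net costs `5 ^ m ≤ exp (2m)`.
  have h1 : -s ^ 2 / (2 * (2 * ν) ^ 2) = -(3 * m) := by
    rw [hs]
    field_simp
    ring
  have h5 : (5 : ℝ) ≤ Real.exp 2 := by
    have h := Real.exp_one_gt_d9
    have h2 : Real.exp 2 = Real.exp 1 * Real.exp 1 := by rw [← Real.exp_add]; norm_num
    rw [h2]
    nlinarith
  have h6 : (5 : ℝ) ^ m ≤ Real.exp (2 * m) := by
    rw [mul_comm, Real.exp_nat_mul]
    gcongr
  rw [h1]
  calc (5 : ℝ) ^ m * (2 * Real.exp (-(3 * m))) ≤ Real.exp (2 * m) * (2 * Real.exp (-(3 * m))) := by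
        gcongr
    _ = 2 * (Real.exp (2 * m) * Real.exp (-(3 * m))) := by ring
    _ = _ := by rw [← Real.exp_add]; ring_nf

end TensorFactor

theorem mainTheorem7 {ι : Type*} (l : Filter ι) (K : ℕ) [NeZero K] (r : Fin K → ℕ)
    (𝒜 : ∀ k, Set (Fin (r k) → ℝ)) (ℱ : Set (TensorFactor.Tensor r))
    (T : ι → ℕ) (p : ι → Fin K → ℕ)
    (hT : Tendsto T l atTop) (hp : ∀ k, Tendsto (fun n => p n k) l atTop)
    (θ₀ : ∀ n, TensorFactor.Param (p n) r (T n))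
    (hθ₀ : TensorFactor.ParamAssumption l 𝒜 ℱ T p θ₀)
    {Ω : ι → Type*} [∀ n, MeasurableSpace (Ω n)]
    (μ : ∀ n, Measure (Ω n)) [∀ n, IsProbabilityMeasure (μ n)]
    (e : ∀ n, Fin (T n) → (∀ k, Fin (p n k)) → Ω n → ℝ)
    (hindep : ∀ n, TensorFactor.NoiseIndep (μ n) (e n))
    (ν : ℝ) (hν : 0 < ν) (hsub : ∀ n, TensorFactor.NoiseSubGaussian (μ n) ν (e n))
    (τ : ℝ) (hτ : 0 < τ)
    (θhat : ∀ n, Ω n → TensorFactor.Param (p n) r (T n))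
    (hest : ∀ n, ∀ᵐ ω ∂(μ n), TensorFactor.IsHuberEstimate 𝒜 ℱ τ
      (fun t i => (θ₀ n).signal t i + e n t i ω) (θhat n ω)) :
    TensorFactor.IsBigOP l μ
      (fun n ω => TensorFactor.signalError (θhat n ω) (θ₀ n))
      (fun n => 1 / (TensorFactor.Lstar (T n) (p n) : ℝ)) := by
  open TensorFactor in
  intro ε hε
  obtain ⟨M, hM0, hM⟩ := exists_frob_le hθ₀.bounded_factors
  set c₁ : ℝ := (τ + 2 * ν + 2 * M) / τ with hc₁
  have hc₁0 : 0 ≤ c₁ := by positivity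
  set R : ℝ := ∏ k, (2 * r k : ℝ) with hR
  set a : ℝ := c₁ * (2 * (R * 2 ^ (K + 1))) ^ 2 * (24 * ν ^ 2) with ha
  have ha0 : 0 ≤ a := by positivity
  -- Makes the Markov bound `3 / c` equal to `ε / 2`.
  set c : ℝ := 6 / ε with hc
  have hc0 : 0 < c := by positivity
  -- The final `+ 1` only keeps the constant positive.
  refine ⟨a * (K + 1) + (2 * M) ^ 2 * c + 1, by positivity, ?_⟩
  have hexp : ∀ᶠ n in l, 2 * Real.exp (-(T n : ℝ)) ≤ ε / 2 := by
    have h : Tendsto (fun n => 2 * Real.exp (-(T n : ℝ))) l (𝓝 (2 * 0)) :=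
      (Real.tendsto_exp_neg_atTop_nhds_zero.comp
        (tendsto_natCast_atTop_atTop.comp hT)).const_mul 2
    rw [mul_zero] at h
    exact h.eventually_le_const (by positivity)
  filter_upwards [hexp, hT.eventually_gt_atTop 0,
    eventually_all.2 fun k => (hp k).eventually_gt_atTop 0] with n hn hTn hpn
  have hPn : 0 < ∏ k, p n k := Finset.prod_pos fun k _ => hpn k
  have hP0 : (0 : ℝ) < ((∏ k, p n k : ℕ) : ℝ) := Nat.cast_pos.2 hPn
  have hT0 : (0 : ℝ) < T n := Nat.cast_pos.2 hTn
  obtain ⟨hdim, hdimP⟩ := dims_div_le hTn hpn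
  set m : ℕ := T n + ∑ k, p n k with hm
  set s : ℝ := Real.sqrt (24 * ν ^ 2 * m) with hs
  have hs0 : 0 ≤ s := Real.sqrt_nonneg _
  have hs2 : s ^ 2 = 24 * ν ^ 2 * m := Real.sq_sqrt (by positivity)
  have hb1 := measure_arrayForm_bound (hindep n) hν (hsub n) hs0
  have hb2 := measure_card_large_gt_le (hindep n) hν (hsub n) hTn hPn hc0
  have hb3 : μ n {ω | ¬ IsHuberEstimate 𝒜 ℱ τ
      (fun t i => (θ₀ n).signal t i + e n t i ω) (θhat n ω)} = 0 := ae_iff.1 (hest n)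
  have hb1' : ENNReal.ofReal (5 ^ (T n + ∑ k, p n k) *
      (2 * Real.exp (-s ^ 2 / (2 * (2 * ν) ^ 2)))) ≤ ENNReal.ofReal (ε / 2) := by
    refine ENNReal.ofReal_le_ofReal ((net_tail_le hν hs2).trans (le_trans ?_ hn))
    gcongr
    rw [hm]
    exact Nat.le_add_right _ _
  have hb2' : (3 : ℝ) / c = ε / 2 := by
    rw [hc]
    field_simp
    norm_num
  rw [hb2'] at hb2
  have hsplit : ENNReal.ofReal ε = ENNReal.ofReal (ε / 2) + ENNReal.ofReal (ε / 2) + 0 := by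
    rw [add_zero, ← ENNReal.ofReal_add (by positivity) (by positivity), add_halves]
  rw [hsplit]
  -- Three exceptional events: a large noise form, too many large noise tensors, and the null set
  -- where the estimate is not a minimiser.
  refine le_trans (measure_mono fun ω hω => ?_) ((measure_union_le _ _).trans (add_le_add
    ((measure_union_le _ _).trans (add_le_add (hb1.trans hb1') hb2)) hb3.le))
  by_contra hcon
  simp only [Set.mem_union, Set.mem_ofPred_eq, not_or, not_not, not_lt] at hcon
  obtain ⟨⟨hform, hcnt⟩, hhub⟩ := hcon
  refine absurd (Set.mem_ofPred_eq ▸ hω) (not_lt.2 ?_)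
  have hdet := sum_frob_sq_le hτ (by positivity : 0 ≤ 2 * ν) hM0
    (by positivity : 0 ≤ 2 ^ (K + 1) * s) hTn hPn (fun t i => e n t i ω) hform (θhat n ω) (θ₀ n)
    (hhub.2 _ (hθ₀.mem n)) (frob_signal_sub_sq_le hM hpn hhub.1 (hθ₀.mem n))
  have hdet' : ∑ t, ((θhat n ω).signal t - (θ₀ n).signal t).frob ^ 2 ≤
      a * m + (2 * M) ^ 2 * (c * T n) := by
    refine hdet.trans (add_le_add (le_of_eq ?_) ?_)
    · calc _ = c₁ * (2 * (R * 2 ^ (K + 1))) ^ 2 * s ^ 2 := by ring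
        _ = _ := by rw [hs2, ha]; ring
    · calc _ ≤ (2 * M) ^ 2 * ((∏ k, p n k : ℕ) : ℝ) *
            (c * (T n / ((∏ k, p n k : ℕ) : ℝ))) := by gcongr
        _ = _ := by field_simp
  rw [abs_of_nonneg (div_nonneg (Finset.sum_nonneg fun _ _ => sq_nonneg _) (by positivity))]
  set L : ℝ := 1 / (Lstar (T n) (p n) : ℝ) with hL
  have hL0 : 0 ≤ L := by positivity
  calc signalError (θhat n ω) (θ₀ n)
      ≤ (a * m + (2 * M) ^ 2 * (c * T n)) / (T n * ((∏ k, p n k : ℕ) : ℝ)) := by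
        unfold signalError
        gcongr
    _ = a * (m / (T n * ((∏ k, p n k : ℕ) : ℝ))) +
        (2 * M) ^ 2 * c * (1 / ((∏ k, p n k : ℕ) : ℝ)) := by field_simp
    _ ≤ a * ((K + 1) * L) + (2 * M) ^ 2 * c * L := by gcongr
    _ ≤ (a * (K + 1) + (2 * M) ^ 2 * c + 1) * L := by linarith
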